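/- Let $n\ge 0$, $\sigma>0$, let $\mathcal M$ be a finite set of models, let $\hat M:\mathbb R^n\to\mathcal M$ be a measurable selection rule and let $(H_M)_{M\in\mathcal M}$ be arbitrary real $n\times n$ matrices. Let $\Theta\subseteq\mathbb R^n$ be the set of possible values of the mean vector $\mu=\mu(X)$ (the feature matrix $X$ being fixed), and suppose that $\Theta$ contains a ball of positive radius in $\mathbb R^n$. For $\alpha>0$ and $\mu\in\Theta$ let $y\sim N(\mu,\sigma^2 I)$, $\omega\sim N(0,\alpha\sigma^2 I)$ and $y_{new}\sim N(\mu,\sigma^2I)$ be independent, and put $$\mathrm{Err}_\alpha=\mathrm{Err}_\alpha(\mu)=E_\mu\big\|y_{new}-H_{\hat M(y+\omega)}\,y\big\|_2^2,$$ $$\widehat{\mathrm{Err}}_\alpha(y,\omega)=\Big\|y-\tfrac1\alpha\omega-H_{\hat M(y+\omega)}\,y\Big\|_2^2+2\,\mathrm{tr}\big(H_{\hat M(y+\omega)}\big)\sigma^2-\tfrac1\alpha n\sigma^2,$$ $$\widehat{\mathrm{Err}}^{(I)}_\alpha(y)=E_\omega\big[\widehat{\mathrm{Err}}_\alpha\mid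 y\big]=\int\widehat{\mathrm{Err}}_\alpha(y,w)\,N(0,\alpha\sigma^2I)(dw).$$ Then for every $\alpha>0$ the expectations defining $\mathrm{Err}_\alpha(\mu)$, $\mu\in\Theta$, and $\widehat{\mathrm{Err}}^{(I)}_\alpha(y)$, $y\in\mathbb R^n$, are finite; for every $\mu\in\Theta$, $\widehat{\mathrm{Err}}^{(I)}_\alpha(y)$ is a version of the conditional expectation of $\widehat{\mathrm{Err}}_\alpha(y,\omega)$ given $y$; and $\widehat{\mathrm{Err}}^{(I)}_\alpha$ is a uniform minimum variance unbiased (UMVU) estimator of $\mathrm{Err}_\alpha$. That is, for every $\mu\in\Theta$ it has finite second moment and mean $\mathrm{Err}_\alpha(\mu)$, and for every measurable $\delta:\mathbb R^n\times\mathbb R^n\to\mathbb R$ with $E_\mu|\delta(y,\omega)|<\infty$ and $E_\mu\,\delta(y,\omega)=\mathrm{Err}_\alpha(\mu)$ for all $\mu\in\Theta$ (in particular for every such $\delta$ depending on $y$ only), $$\mathrm{Var}_\mu\big(\widehat{\mathrm{Err}}^{(I)}_\alpha(y)\big)\le\mathrm{Var}_\mu\big(\delta(y,\omega)\big)\in[0,\infty]\qquad\text{for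 all }\mu\in\Theta.$$ -/

import Mathlib

open MeasureTheory ProbabilityTheory
open scoped ENNReal

noncomputable section

namespace RandSel

/-! ### Unbiased and UMVU estimators

A statistical model with sample space `X` and parameter space `T` (a set of parameters) is a
family of measures `P θ` on `X`. An estimand is a function `g` of the parameter and an estimator is
a measurable function on the sample space. -/

/-- The estimator `d` is unbiased for `g`: under every parameter value it has a finite mean,
which is equal to `g θ`. -/
structure IsUnbiased {X ι : Type*} [MeasurableSpace X] (P : ι → Measure X) (T : Set ι)
    (g : ι → ℝ) (d : X → ℝ) : Prop where
  measurable : Measurable d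
  integrable : ∀ θ ∈ T, Integrable d (P θ)
  mean_eq : ∀ θ ∈ T, ∫ x, d x ∂(P θ) = g θ

/-- The estimator `d` is a uniform minimum variance unbiased (UMVU) estimator of `g`: it is
unbiased with finite second moment, and at every parameter value its variance is at most the
variance of any other unbiased estimator. The variance `evariance` is a number in `[0, ∞]`, so
competitors with infinite variance are treated correctly. -/
structure IsUMVU {X ι : Type*} [MeasurableSpace X] (P : ι → Measure X) (T : Set ι)
    (g : ι → ℝ) (d : X → ℝ) : Prop where
  unbiased : IsUnbiased P T g d
  memLp_two : ∀ θ ∈ T, MemLp d 2 (P θ)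
  variance_le : ∀ d' : X → ℝ, IsUnbiased P T g d' →
    ∀ θ ∈ T, evariance d (P θ) ≤ evariance d' (P θ)

/-! ### The randomized selection model -/

/-- The Gaussian distribution `N(m, v I)` on `ℝⁿ`. -/
def gauss {n : ℕ} (m : EuclideanSpace ℝ (Fin n)) (v : ℝ) : Measure (EuclideanSpace ℝ (Fin n)) :=
  multivariateGaussian m (v • (1 : Matrix (Fin n) (Fin n) ℝ))

/-- The joint law of `(y, ω)`, where `y ∼ N(m, σ² I)` and `ω ∼ N(0, α σ² I)` are independent. -/
def dataLaw {n : ℕ} (σ α : ℝ) (m : EuclideanSpace ℝ (Fin n)) :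
    Measure (EuclideanSpace ℝ (Fin n) × EuclideanSpace ℝ (Fin n)) :=
  (gauss m (σ ^ 2)).prod (gauss 0 (α * σ ^ 2))

/-- The estimation rule `H_{M̂(y + ω)} y`. -/
def fit {n : ℕ} {M : Type*} (H : M → Matrix (Fin n) (Fin n) ℝ)
    (sel : EuclideanSpace ℝ (Fin n) → M) (y ω : EuclideanSpace ℝ (Fin n)) :
    EuclideanSpace ℝ (Fin n) :=
  Matrix.toEuclideanLin (H (sel (y + ω))) y

/-- The prediction error `Err_α = E ‖y_new - H_{M̂(y + ω)} y‖²` as a function of the mean vector `m`,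
where `y_new ∼ N(m, σ² I)` is independent of `(y, ω)`. -/
def predErr {n : ℕ} {M : Type*} (H : M → Matrix (Fin n) (Fin n) ℝ)
    (sel : EuclideanSpace ℝ (Fin n) → M) (σ α : ℝ) (m : EuclideanSpace ℝ (Fin n)) : ℝ :=
  ∫ p, ‖p.2 - fit H sel p.1.1 p.1.2‖ ^ 2 ∂((dataLaw σ α m).prod (gauss m (σ ^ 2)))

/-- The estimator
`‖y⁻ - H_{M̂(y + ω)} y‖² + 2 tr(H_{M̂(y + ω)}) σ² - n σ² / α`, where `y⁻ = y - ω / α`. -/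
def errHat {n : ℕ} {M : Type*} (H : M → Matrix (Fin n) (Fin n) ℝ)
    (sel : EuclideanSpace ℝ (Fin n) → M) (σ α : ℝ) (y ω : EuclideanSpace ℝ (Fin n)) : ℝ :=
  ‖(y - (1 / α) • ω) - fit H sel y ω‖ ^ 2 + 2 * (H (sel (y + ω))).trace * σ ^ 2
    - (1 / α) * n * σ ^ 2

/-- The Rao–Blackwellized estimator: `errHat` averaged over `ω ∼ N(0, α σ² I)` with `y` held
fixed. -/
def errHatI {n : ℕ} {M : Type*} (H : M → Matrix (Fin n) (Fin n) ℝ)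
    (sel : EuclideanSpace ℝ (Fin n) → M) (σ α : ℝ) (y : EuclideanSpace ℝ (Fin n)) : ℝ :=
  ∫ ω, errHat H sel σ α y ω ∂(gauss 0 (α * σ ^ 2))

end RandSel

end

/-! Put `u = y + ω` and `z = y - ω / α`. These are independent Gaussians with mean `m`
(`map_dataLaw`), and `y = (u + α z) / (1 + α)`. With `u` fixed the selected matrix `K` is fixed, so
the fit is affine in `z` with linear part `α / (1 + α) K`. The classical trace correction for linear
smoothers (`integral_normSq_sub_normSq_gauss`) then applies in `z`, whose variance is `(1 + 1 / α)
σ²`, and the correction is exactly `2 σ² tr K`. Hence `errHat` is unbiased (`integral_errHat`), and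
so is its conditional expectation `errHatI` given `y`.

Optimality is Lehmann–Scheffé. Averaging a competitor over `ω` is conditioning on `y`: the mean is
kept and the variance does not grow (`evariance_condExp_le`). The result and `errHatI` are unbiased
functions of `y` alone, so they agree almost everywhere by completeness of the Gaussian location
family over a ball (`ae_eq_zero_of_integral_gauss_eq_zero`). -/

namespace RandSel

/-! ### Uniqueness of measures from moment generating functions near zero -/

open Complex in
/-- Finite measures with the same moment generating function near zero are equal. -/
lemma ext_of_mgf_inner_eq {E : Type*} [NormedAddCommGroup E] [InnerProductSpace ℝ E]
    [CompleteSpace E] [SecondCountableTopology E] [MeasurableSpace E] [BorelSpace E]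
    {μ ν : Measure E} [IsFiniteMeasure μ] [IsFiniteMeasure ν] {r : ℝ} (hr : 0 < r)
    (hμ : ∀ t : E, ‖t‖ < r → Integrable (fun x => Real.exp (inner ℝ x t)) μ)
    (hν : ∀ t : E, ‖t‖ < r → Integrable (fun x => Real.exp (inner ℝ x t)) ν)
    (h : ∀ t : E, ‖t‖ < r →
      ∫ x, Real.exp (inner ℝ x t) ∂μ = ∫ x, Real.exp (inner ℝ x t) ∂ν) :
    μ = ν := by
  refine Measure.ext_of_charFun (funext fun t => ?_)
  set X : E → ℝ := fun x => inner ℝ x t with hX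
  have key : ∀ᶠ s : ℝ in nhds 0, ‖s • t‖ < r := by
    have : Filter.Tendsto (fun s : ℝ => ‖s • t‖) (nhds 0) (nhds ‖(0 : ℝ) • t‖) :=
      (by fun_prop : Continuous fun s : ℝ => ‖s • t‖).tendsto 0
    exact this.eventually (gt_mem_nhds (by simpa using hr))
  have hint : ∀ {κ : Measure E}, (∀ t : E, ‖t‖ < r →
      Integrable (fun x => Real.exp (inner ℝ x t)) κ) → 0 ∈ interior (integrableExpSet X κ) := by
    intro κ hκ
    rw [mem_interior_iff_mem_nhds]
    filter_upwards [key] with s hs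
    simpa [integrableExpSet, hX, inner_smul_right] using hκ _ hs
  have hmgf : ∀ᶠ s : ℝ in nhds 0, mgf X μ s = mgf X ν s := by
    filter_upwards [key] with s hs
    simpa [mgf, hX, inner_smul_right] using h _ hs
  have hconv : Convex ℝ {z : ℂ | z.re ∈ interior (integrableExpSet X μ) ∩
      interior (integrableExpSet X ν)} :=
    (convex_integrableExpSet.interior.inter convex_integrableExpSet.interior).linear_preimage reLm
  -- Both transforms of the projection `X` are analytic on this vertical strip and agree at real
  -- points near 0, so the identity theorem applies. The point `I` has real part 0, hence lies in
  -- the strip, and evaluation there gives the characteristic function at `t`.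
  have heq : Set.EqOn (complexMGF X μ) (complexMGF X ν)
      {z : ℂ | z.re ∈ interior (integrableExpSet X μ) ∩ interior (integrableExpSet X ν)} := by
    refine AnalyticOnNhd.eqOn_of_preconnected_of_frequently_eq
      (analyticOnNhd_complexMGF.mono fun z hz => hz.1)
      (analyticOnNhd_complexMGF.mono fun z hz => hz.2) hconv.isPreconnected
      (z₀ := ((0 : ℝ) : ℂ)) (by simpa using ⟨hint hμ, hint hν⟩) ?_
    have hreal : ∃ᶠ s : ℝ in nhdsWithin 0 {0}ᶜ, complexMGF X μ s = complexMGF X ν s := by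
      refine (Filter.Eventually.filter_mono nhdsWithin_le_nhds ?_).frequently
      filter_upwards [hmgf] with s hs
      rw [complexMGF_ofReal, complexMGF_ofReal, hs]
    refine Filter.Tendsto.frequently ?_ hreal
    rw [tendsto_nhdsWithin_iff]
    refine ⟨(continuous_ofReal.tendsto 0).mono_left nhdsWithin_le_nhds, ?_⟩
    filter_upwards [self_mem_nhdsWithin] with s hs
    simpa using hs
  have := heq (x := I) (by simpa using ⟨hint hμ, hint hν⟩)
  simpa [complexMGF, charFun_apply, hX, mul_comm] using this

/-! ### Isotropic Gaussians: transforms, tilting and completeness -/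

variable {n : ℕ}
local notation "𝔼" => EuclideanSpace ℝ (Fin n)

instance isGaussian_gauss (m : 𝔼) (v : ℝ) : IsGaussian (gauss m v) := by
  unfold gauss; infer_instance

lemma charFun_gauss (m : 𝔼) {v : ℝ} (hv : 0 ≤ v) (t : 𝔼) :
    charFun (gauss m v) t = Complex.exp (inner ℝ t m * Complex.I - v * ‖t‖ ^ 2 / 2) := by
  have hS : (v • (1 : Matrix (Fin n) (Fin n) ℝ)).PosSemidef := Matrix.PosSemidef.one.smul hv
  rw [gauss, charFun_multivariateGaussian hS]
  congr 3
  rw [Matrix.smul_mulVec, Matrix.one_mulVec, dotProduct_smul, smul_eq_mul,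
    ← Complex.ofReal_pow, EuclideanSpace.real_norm_sq_eq]
  simp [dotProduct, sq]

lemma gauss_eq_map_pi (m : 𝔼) {v : ℝ} (hv : 0 ≤ v) :
    gauss m v = (Measure.pi fun i => gaussianReal (m i) v.toNNReal).map (WithLp.toLp 2) := by
  refine Measure.ext_of_charFun (E := 𝔼) (funext fun t => ?_)
  rw [charFun_gauss m hv, charFun_pi]
  simp_rw [charFun_gaussianReal, ← Complex.exp_sum, ← Complex.ofReal_pow,
    EuclideanSpace.real_norm_sq_eq]
  simp [PiLp.inner_apply, hv, Finset.sum_sub_distrib, Finset.mul_sum,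
    Finset.sum_div, mul_comm]

/-- Complex coefficients let one formula cover both the normalizing constant of an exponential tilt
and the characteristic function of the tilted measure. -/
lemma integral_cexp_gauss (m : 𝔼) {v : ℝ} (hv : 0 ≤ v) (a : Fin n → ℂ) :
    ∫ x, Complex.exp (∑ i, a i * x i) ∂(gauss m v) =
      Complex.exp (∑ i, (a i * m i + v * a i ^ 2 / 2)) := by
  rw [gauss_eq_map_pi m hv, integral_map (by fun_prop)
    (Measurable.aestronglyMeasurable (by fun_prop))]
  simp_rw [Complex.exp_sum]
  rw [integral_fintype_prod_eq_prod (𝕜 := ℂ)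
    (f := fun i (x : ℝ) => Complex.exp (a i * x))]
  refine Finset.prod_congr rfl fun i _ => ?_
  have := complexMGF_id_gaussianReal (μ := m i) (v := v.toNNReal) (a i)
  simpa [complexMGF, hv] using this

lemma integrable_exp_inner_gauss (m : 𝔼) (v : ℝ) (h : 𝔼) :
    Integrable (fun x => Real.exp (inner ℝ h x)) (gauss m v) := by
  have h1 := IsGaussian.map_eq_gaussianReal (μ := gauss m v) (innerSL ℝ h)
  have h2 := integrable_exp_mul_gaussianReal (μ := (gauss m v)[innerSL ℝ h])
    (v := (Var[innerSL ℝ h; gauss m v]).toNNReal) 1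
  rw [← h1, integrable_map_measure (by fun_prop) (by fun_prop)] at h2
  simpa [Function.comp_def] using h2

/-- Cameron–Martin formula for isotropic Gaussian measures. -/
lemma gauss_add_eq_tilted (c h : 𝔼) {v : ℝ} (hv : 0 < v) :
    gauss (c + h) v = (gauss c v).tilted fun x => inner ℝ (v⁻¹ • h) x := by
  have hi := integrable_exp_inner_gauss c v (v⁻¹ • h)
  have := isProbabilityMeasure_tilted hi
  refine Measure.ext_of_charFun (funext fun t => ?_)
  have hZ : ((∫ x, Real.exp (inner ℝ (v⁻¹ • h) x) ∂(gauss c v) : ℝ) : ℂ) =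
      Complex.exp (∑ i, (((v⁻¹ * h i : ℝ) : ℂ) * c i + v * ((v⁻¹ * h i : ℝ) : ℂ) ^ 2 / 2)) := by
    rw [← integral_cexp_gauss c hv.le, ← integral_complex_ofReal]
    congr 1 with x
    simp [PiLp.inner_apply, mul_comm]
  rw [charFun_gauss _ hv.le, charFun_apply, integral_tilted]
  simp_rw [Complex.real_smul, Complex.ofReal_div, hZ, div_mul_eq_mul_div]
  rw [integral_div]
  have hN : ∫ x, ((Real.exp (inner ℝ (v⁻¹ • h) x) : ℝ) : ℂ) *
      Complex.exp (inner ℝ x t * Complex.I) ∂(gauss c v) =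
      Complex.exp (∑ i, ((((v⁻¹ * h i : ℝ) : ℂ) + t i * Complex.I) * c i +
        v * (((v⁻¹ * h i : ℝ) : ℂ) + t i * Complex.I) ^ 2 / 2)) := by
    rw [← integral_cexp_gauss c hv.le]
    congr 1 with x
    rw [Complex.ofReal_exp, ← Complex.exp_add]
    congr 1
    simp only [PiLp.inner_apply, Complex.ofReal_sum, Finset.sum_mul, ← Finset.sum_add_distrib]
    refine Finset.sum_congr rfl fun i _ => ?_
    simp
    ring
  rw [hN, ← Complex.exp_sub, ← Finset.sum_sub_distrib]
  congr 1
  rw [← Complex.ofReal_pow, EuclideanSpace.real_norm_sq_eq]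
  simp only [PiLp.inner_apply, Complex.ofReal_sum, Finset.sum_mul, Finset.mul_sum, Finset.sum_div,
    ← Finset.sum_sub_distrib]
  refine Finset.sum_congr rfl fun i _ => ?_
  have hv' : (v : ℂ) ≠ 0 := by exact_mod_cast hv.ne'
  simp
  field_simp
  ring_nf
  simp only [Complex.I_sq]
  ring

/-- Carries an almost-everywhere identity at the centre of the ball to every mean, including means
outside the ball. -/
lemma gauss_absolutelyContinuous (c m : 𝔼) {v : ℝ} (hv : 0 < v) : gauss m v ≪ gauss c v := by
  have := gauss_add_eq_tilted c (m - c) hv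
  rw [add_sub_cancel] at this
  rw [this]
  exact tilted_absolutelyContinuous _ _

/-- Completeness of the isotropic Gaussian location family over a ball. -/
lemma ae_eq_zero_of_integral_gauss_eq_zero {f : 𝔼 → ℝ} (hf : Measurable f) {v : ℝ} (hv : 0 < v)
    {c : 𝔼} {r : ℝ} (hr : 0 < r) (hint : ∀ m ∈ Metric.ball c r, Integrable f (gauss m v))
    (hzero : ∀ m ∈ Metric.ball c r, ∫ x, f x ∂(gauss m v) = 0) :
    f =ᵐ[gauss c v] 0 := by
  have hfc := hint c (Metric.mem_ball_self hr)
  -- Tilting by `t` shifts the mean by `v • t`, so means in the ball of radius `r` correspond to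
  -- tilts of norm below `r / v`.
  have htilt : ∀ t : 𝔼, ‖t‖ < r / v →
      gauss (c + v • t) v = (gauss c v).tilted (fun x => inner ℝ t x) ∧
        c + v • t ∈ Metric.ball c r := by
    intro t ht
    refine ⟨?_, ?_⟩
    · rw [gauss_add_eq_tilted c _ hv, smul_smul, inv_mul_cancel₀ hv.ne', one_smul]
    · rw [lt_div_iff₀ hv] at ht
      simpa [norm_smul, abs_of_pos hv, mul_comm] using ht
  have hint' : ∀ t : 𝔼, ‖t‖ < r / v →
      Integrable (fun x => Real.exp (inner ℝ x t) * f x) (gauss c v) := by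
    intro t ht
    have h := hint _ (htilt t ht).2
    rw [(htilt t ht).1, integrable_tilted_iff] at h
    · simpa [real_inner_comm] using h
    · exact integrable_exp_inner_gauss c v t
  have hzero' : ∀ t : 𝔼, ‖t‖ < r / v →
      ∫ x, Real.exp (inner ℝ x t) * f x ∂(gauss c v) = 0 := by
    intro t ht
    have h := hzero _ (htilt t ht).2
    rw [(htilt t ht).1, integral_tilted] at h
    simp_rw [smul_eq_mul, div_mul_eq_mul_div] at h
    rw [integral_div, div_eq_zero_iff] at h
    have hpos := integral_exp_pos (integrable_exp_inner_gauss c v t)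
    rcases h with h | h
    · simpa [real_inner_comm] using h
    · exact absurd h hpos.ne'
  -- `ENNReal.ofReal` truncates at 0, so `f` and `-f` yield the positive and negative parts of `f`
  -- as densities of two finite measures. Vanishing means make their moment generating functions
  -- agree near zero.
  have hpart : ∀ g : 𝔼 → ℝ, Measurable g → (∀ t : 𝔼, ‖t‖ < r / v →
      Integrable (fun x => Real.exp (inner ℝ x t) * g x) (gauss c v)) → ∀ t : 𝔼, ‖t‖ < r / v →
      Integrable (fun x => Real.exp (inner ℝ x t))
        ((gauss c v).withDensity fun x => ENNReal.ofReal (g x)) ∧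
      ∫ x, Real.exp (inner ℝ x t) ∂((gauss c v).withDensity fun x => ENNReal.ofReal (g x)) =
        ∫ x, Real.exp (inner ℝ x t) * max (g x) 0 ∂(gauss c v) := by
    intro g hg hgi t ht
    constructor
    · rw [integrable_withDensity_iff (by fun_prop) (by simp)]
      refine (hgi t ht).mono (by fun_prop) (Filter.Eventually.of_forall fun x => ?_)
      rw [norm_mul, norm_mul]
      refine mul_le_mul_of_nonneg_left ?_ (norm_nonneg _)
      rw [ENNReal.toReal_ofReal', Real.norm_eq_abs, Real.norm_eq_abs,
        abs_of_nonneg (le_max_right _ _)]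
      exact max_le (le_abs_self _) (abs_nonneg _)
    · rw [integral_withDensity_eq_integral_toReal_smul (by fun_prop) (by simp)]
      simp [ENNReal.toReal_ofReal', mul_comm]
  have hneg : ∀ t : 𝔼, ‖t‖ < r / v →
      Integrable (fun x => Real.exp (inner ℝ x t) * (-f x)) (gauss c v) := by
    intro t ht
    simpa using (hint' t ht).neg
  have hfin : ∀ g : 𝔼 → ℝ, Integrable g (gauss c v) →
      IsFiniteMeasure ((gauss c v).withDensity fun x => ENNReal.ofReal (g x)) :=
    fun g hg => isFiniteMeasure_withDensity_ofReal hg.2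
  have := hfin f hfc
  have := hfin (fun x => -f x) hfc.neg
  have heq : (gauss c v).withDensity (fun x => ENNReal.ofReal (f x)) =
      (gauss c v).withDensity (fun x => ENNReal.ofReal (-f x)) := by
    refine ext_of_mgf_inner_eq (div_pos hr hv) (fun t ht => (hpart f hf hint' t ht).1)
      (fun t ht => (hpart _ hf.neg hneg t ht).1) fun t ht => ?_
    have hi1 : Integrable (fun x => Real.exp (inner ℝ x t) * max (f x) 0) (gauss c v) := by
      simpa [mul_max_of_nonneg, Real.exp_nonneg] using (hint' t ht).pos_part
    have hi2 : Integrable (fun x => Real.exp (inner ℝ x t) * max (-f x) 0) (gauss c v) := by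
      simpa [mul_max_of_nonneg, Real.exp_nonneg] using (hneg t ht).pos_part
    have hp2 := (hpart (fun x => -f x) hf.neg hneg t ht).2
    rw [(hpart f hf hint' t ht).2, hp2, ← sub_eq_zero, ← integral_sub hi1 hi2]
    refine Eq.trans ?_ (hzero' t ht)
    congr 1 with x
    rw [← mul_sub]
    congr 1
    rcases le_total (f x) 0 with h | h
    · rw [max_eq_right h, max_eq_left (by linarith)]; ring
    · rw [max_eq_left h, max_eq_right (by linarith)]; ring
  rw [withDensity_eq_iff (by fun_prop) (by fun_prop)] at heq
  · filter_upwards [heq] with x hx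
    rcases lt_trichotomy (f x) 0 with h | h | h
    · rw [ENNReal.ofReal_of_nonpos h.le, eq_comm, ENNReal.ofReal_eq_zero] at hx
      linarith
    · exact h
    · rw [ENNReal.ofReal_of_nonpos (p := -f x) (by linarith), ENNReal.ofReal_eq_zero] at hx
      linarith
  · exact hfc.lintegral_lt_top.ne

/-! ### Gaussian moments, the independent pair and the trace identity -/

lemma memLp_id_gauss (m : 𝔼) (v : ℝ) {p : ℝ≥0∞} (hp : p ≠ ∞) : MemLp (fun x => x) p (gauss m v) :=
  IsGaussian.memLp_id (gauss m v) p hp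

lemma integral_gauss (m : 𝔼) (v : ℝ) : ∫ x, x ∂(gauss m v) = m :=
  integral_id_multivariateGaussian

/-- `E ⟪z - m, K (z - m)⟫ = v tr K` for `z ∼ N(m, v I)`. -/
lemma integral_inner_gauss (m : 𝔼) {v : ℝ} (hv : 0 ≤ v) (K : Matrix (Fin n) (Fin n) ℝ) :
    ∫ z, inner ℝ (z - m) (Matrix.toEuclideanLin K (z - m)) ∂(gauss m v) = v * K.trace := by
  have hS : (v • (1 : Matrix (Fin n) (Fin n) ℝ)).PosSemidef := Matrix.PosSemidef.one.smul hv
  have hcoord : ∀ i, MemLp (fun z : 𝔼 => z i - m i) 2 (gauss m v) := fun i =>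
    (IsGaussian.memLp_dual (gauss m v) (EuclideanSpace.proj i) 2 (by simp)).sub (memLp_const _)
  have hcov : ∀ i j, ∫ z : 𝔼, (z i - m i) * (z j - m j) ∂(gauss m v) =
      (v • (1 : Matrix (Fin n) (Fin n) ℝ)) i j := by
    intro i j
    have hmean : ∀ i, ∫ z : 𝔼, z i ∂(gauss m v) = m i := fun i => by
      have := IsGaussian.integral_dual (μ := gauss m v) (EuclideanSpace.proj i)
      rw [integral_gauss] at this
      simpa using this
    rw [← covariance_eval_multivariateGaussian (μ := m) hS i j, covariance]
    change _ = ∫ z : 𝔼, (z i - ∫ z : 𝔼, z i ∂(gauss m v)) * (z j - ∫ z : 𝔼, z j ∂(gauss m v))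
      ∂(gauss m v)
    rw [hmean, hmean]
  have hexp : ∀ z : 𝔼, inner ℝ (z - m) (Matrix.toEuclideanLin K (z - m)) =
      ∑ i, ∑ j, K i j * ((z i - m i) * (z j - m j)) := by
    intro z
    simp only [PiLp.inner_apply, Matrix.toLpLin_apply, Matrix.mulVec, dotProduct]
    refine Finset.sum_congr rfl fun i _ => ?_
    simp [Finset.sum_mul]
    exact Finset.sum_congr rfl fun j _ => by ring
  simp_rw [hexp]
  have hint : ∀ i j, Integrable (fun z : 𝔼 => K i j * ((z i - m i) * (z j - m j))) (gauss m v) :=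
    fun i j => ((hcoord i).integrable_mul (hcoord j)).const_mul _
  rw [integral_finsetSum _ fun i _ => integrable_finsetSum _ fun j _ => hint i j]
  simp_rw [integral_finsetSum _ fun j _ => hint _ j, integral_const_mul]
  simp [hcov, Matrix.one_apply, Matrix.trace, Finset.mul_sum, mul_comm]

lemma charFunDual_gauss (m : 𝔼) {v : ℝ} (hv : 0 ≤ v) (t : 𝔼) :
    charFunDual (gauss m v) (innerSL ℝ t) =
      Complex.exp (inner ℝ t m * Complex.I - v * ‖t‖ ^ 2 / 2) := by
  rw [← charFun_gauss m hv, charFun_eq_charFunDual_toDualMap]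
  rfl

instance (σ α : ℝ) (m : 𝔼) : IsProbabilityMeasure (dataLaw σ α m) := by
  unfold dataLaw; infer_instance

/-- `y + ω` and `y - ω / α` are independent Gaussian vectors. -/
lemma map_dataLaw {σ α : ℝ} (hα : 0 < α) (m : 𝔼) :
    (dataLaw σ α m).map (fun p => (p.1 + p.2, p.1 - (1 / α) • p.2)) =
      (gauss m ((1 + α) * σ ^ 2)).prod (gauss m ((1 + 1 / α) * σ ^ 2)) := by
  have h1 : 0 ≤ (1 + α) * σ ^ 2 := by positivity
  have h2 : 0 ≤ (1 + 1 / α) * σ ^ 2 := by positivity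
  have h3 : 0 ≤ α * σ ^ 2 := by positivity
  let A : 𝔼 × 𝔼 →L[ℝ] 𝔼 × 𝔼 :=
    (ContinuousLinearMap.fst ℝ 𝔼 𝔼 + ContinuousLinearMap.snd ℝ 𝔼 𝔼).prod
      (ContinuousLinearMap.fst ℝ 𝔼 𝔼 - (1 / α) • ContinuousLinearMap.snd ℝ 𝔼 𝔼)
  have hA : (fun p : 𝔼 × 𝔼 => (p.1 + p.2, p.1 - (1 / α) • p.2)) = A := rfl
  have : IsProbabilityMeasure ((dataLaw σ α m).map A) :=
    Measure.isProbabilityMeasure_map (by fun_prop)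
  rw [hA]
  refine Measure.ext_of_charFunDual (funext fun L => ?_)
  obtain ⟨a, ha⟩ : ∃ a : 𝔼, innerSL ℝ a = L ∘L ContinuousLinearMap.inl ℝ 𝔼 𝔼 :=
    ⟨(InnerProductSpace.toDual ℝ 𝔼).symm _, (InnerProductSpace.toDual ℝ 𝔼).apply_symm_apply _⟩
  obtain ⟨b, hb⟩ : ∃ b : 𝔼, innerSL ℝ b = L ∘L ContinuousLinearMap.inr ℝ 𝔼 𝔼 :=
    ⟨(InnerProductSpace.toDual ℝ 𝔼).symm _, (InnerProductSpace.toDual ℝ 𝔼).apply_symm_apply _⟩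
  have hLv : ∀ x y, L (x, y) = inner ℝ a x + inner ℝ b y := by
    intro x y
    have hxa : inner ℝ a x = L (x, 0) := by
      simpa using congrArg (fun f : 𝔼 →L[ℝ] ℝ => f x) ha
    have hyb : inner ℝ b y = L (0, y) := by
      simpa using congrArg (fun f : 𝔼 →L[ℝ] ℝ => f y) hb
    rw [hxa, hyb, ← map_add]
    simp
  have e1 : (L ∘L A) ∘L ContinuousLinearMap.inl ℝ 𝔼 𝔼 = innerSL ℝ (a + b) := by
    ext x
    simp [A, hLv]
  have e2 : (L ∘L A) ∘L ContinuousLinearMap.inr ℝ 𝔼 𝔼 = innerSL ℝ (a - (1 / α) • b) := by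
    ext x
    simp [A, hLv, inner_smul_right]
    ring
  rw [charFunDual_map, dataLaw, charFunDual_prod, charFunDual_prod, e1, e2, ← ha, ← hb,
    charFunDual_gauss _ (sq_nonneg σ), charFunDual_gauss _ h3, charFunDual_gauss _ h1,
    charFunDual_gauss _ h2, ← Complex.exp_add, ← Complex.exp_add]
  congr 1
  -- In `‖a + b‖² + α ‖a - b / α‖²` the cross terms cancel; this is the independence.
  have n1 : ‖a + b‖ ^ 2 = ‖a‖ ^ 2 + 2 * inner ℝ a b + ‖b‖ ^ 2 := norm_add_sq_real a b
  have n2 : ‖a - (1 / α) • b‖ ^ 2 =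
      ‖a‖ ^ 2 - 2 * ((1 / α) * inner ℝ a b) + (1 / α) ^ 2 * ‖b‖ ^ 2 := by
    rw [norm_sub_sq_real, inner_smul_right, norm_smul, mul_pow, Real.norm_eq_abs, sq_abs]
  simp only [← Complex.ofReal_pow]
  rw [n1, n2, inner_add_left]
  have hα' : (α : ℂ) ≠ 0 := by exact_mod_cast hα.ne'
  simp
  field_simp
  ring

/-- The conditional expectation of `f (x, y)` given `x` under a product measure. -/
lemma condExp_fst_prod {X Y : Type*} [MeasurableSpace X] [MeasurableSpace Y] {μ : Measure X}
    {ν : Measure Y} [IsProbabilityMeasure μ] [IsProbabilityMeasure ν] {f : X × Y → ℝ}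
    (hf : Measurable f) (hfi : Integrable f (μ.prod ν)) :
    (μ.prod ν)[f | MeasurableSpace.comap Prod.fst inferInstance] =ᵐ[μ.prod ν]
      fun p => ∫ y, f (p.1, y) ∂ν := by
  have hm : MeasurableSpace.comap (Prod.fst : X × Y → X) inferInstance ≤
      (inferInstance : MeasurableSpace (X × Y)) := measurable_fst.comap_le
  have hi : Integrable (fun p : X × Y => ∫ y, f (p.1, y) ∂ν) (μ.prod ν) :=
    hfi.integral_prod_left.comp_fst ν
  symm
  refine ae_eq_condExp_of_forall_setIntegral_eq hm hfi (fun s _ _ => hi.integrableOn) ?_ ?_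
  · rintro s ⟨A, hA, rfl⟩ -
    rw [← Set.prod_univ, setIntegral_prod _ hi.integrableOn, setIntegral_prod _ hfi.integrableOn]
    simp
  · refine StronglyMeasurable.aestronglyMeasurable ?_
    exact hf.stronglyMeasurable.integral_prod_right'.comp_measurable (comap_measurable _)

/-- Around `m`, the difference is a quadratic form in `z - m` with matrix `1 - 2 K` plus a linear
term of mean zero; the terms quadratic in `K` cancel. -/
lemma integral_normSq_sub_normSq_gauss (m w : 𝔼) {v : ℝ} (hv : 0 ≤ v)
    (K : Matrix (Fin n) (Fin n) ℝ) :
    Integrable (fun z => ‖z - (w + Matrix.toEuclideanLin K z)‖ ^ 2 -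
      ‖m - (w + Matrix.toEuclideanLin K z)‖ ^ 2) (gauss m v) ∧
    ∫ z, (‖z - (w + Matrix.toEuclideanLin K z)‖ ^ 2 - ‖m - (w + Matrix.toEuclideanLin K z)‖ ^ 2)
      ∂(gauss m v) = n * v - 2 * v * K.trace := by
  have hpt : ∀ z : 𝔼, ‖z - (w + Matrix.toEuclideanLin K z)‖ ^ 2 -
      ‖m - (w + Matrix.toEuclideanLin K z)‖ ^ 2 =
      inner ℝ (z - m) (Matrix.toEuclideanLin (1 - (2 : ℝ) • K) (z - m)) +
        inner ℝ ((2 : ℝ) • (m - (w + Matrix.toEuclideanLin K m))) (z - m) := by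
    intro z
    have hz : z - (w + Matrix.toEuclideanLin K z) =
        (z - m) + (m - (w + Matrix.toEuclideanLin K z)) := by abel
    have hz' : m - (w + Matrix.toEuclideanLin K z) =
        (m - (w + Matrix.toEuclideanLin K m)) - Matrix.toEuclideanLin K (z - m) := by
      rw [map_sub]; abel
    have h1 : Matrix.toEuclideanLin (1 - (2 : ℝ) • K) (z - m) =
        (z - m) - (2 : ℝ) • Matrix.toEuclideanLin K (z - m) := by
      simp [Matrix.toLpLin_one]
    rw [hz, norm_add_sq_real, hz', h1, inner_sub_right (z - m) (z - m), inner_smul_right,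
      inner_smul_left, real_inner_self_eq_norm_sq,
      real_inner_comm (z - m) (m - (w + Matrix.toEuclideanLin K m)),
      inner_sub_right (z - m) (m - (w + Matrix.toEuclideanLin K m))]
    simp only [conj_trivial]
    ring
  have hd : MemLp (fun z : 𝔼 => z - m) 2 (gauss m v) :=
    (memLp_id_gauss m v (by simp)).sub (memLp_const _)
  have hq : Integrable (fun z : 𝔼 => inner ℝ (z - m)
      (Matrix.toEuclideanLin (1 - (2 : ℝ) • K) (z - m))) (gauss m v) := by
    let L := (Matrix.toEuclideanLin (1 - (2 : ℝ) • K)).toContinuousLinearMap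
    have hL : MemLp (fun z : 𝔼 => L (z - m)) 2 (gauss m v) := L.comp_memLp' hd
    refine (hd.norm.integrable_mul hL.norm).mono ?_ (Filter.Eventually.of_forall fun z => ?_)
    · exact hd.1.inner hL.1
    · rw [Pi.mul_apply, norm_mul, norm_norm, norm_norm]
      exact norm_inner_le_norm (z - m) (L (z - m))
  have hl := (hd.const_inner (𝕜 := ℝ)
    ((2 : ℝ) • (m - (w + Matrix.toEuclideanLin K m)))).integrable (by norm_num)
  simp_rw [hpt]
  refine ⟨hq.add hl, ?_⟩
  rw [integral_add hq hl, integral_inner_gauss m hv,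
    integral_inner (hd.integrable (by norm_num)),
    integral_sub ((memLp_id_gauss m v (p := 1) (by simp)).integrable le_rfl)
      (integrable_const _), integral_gauss]
  simp
  ring

/-! ### Measurability, integrability and unbiasedness of the estimator -/

section Fit

variable {M : Type*} [Finite M] {H : M → Matrix (Fin n) (Fin n) ℝ}
  {sel : EuclideanSpace ℝ (Fin n) → M}

lemma measurable_comp_sel (hsel : ∀ k : M, MeasurableSet (sel ⁻¹' {k})) {β : Type*}
    [MeasurableSpace β] (g : M → β) : Measurable fun x => g (sel x) := by
  let _ : MeasurableSpace M := ⊤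
  exact (measurable_from_top (f := g)).comp (measurable_to_countable' hsel)

lemma measurable_fit (hsel : ∀ k : M, MeasurableSet (sel ⁻¹' {k})) :
    Measurable fun p : 𝔼 × 𝔼 => fit H sel p.1 p.2 := by
  let _ : MeasurableSpace M := ⊤
  have h1 : Measurable fun p : 𝔼 × 𝔼 => sel (p.1 + p.2) :=
    (measurable_to_countable' hsel).comp (measurable_fst.add measurable_snd)
  have h2 : Measurable fun q : M × 𝔼 => (Matrix.toEuclideanLin (H q.1)).toContinuousLinearMap q.2 :=
    measurable_from_prod_countable_right fun k =>
      (Matrix.toEuclideanLin (H k)).toContinuousLinearMap.measurable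
  have h3 := h2.comp (h1.prodMk measurable_fst)
  exact h3

variable (H sel) in
-- There are finitely many models, so their operator norms are bounded; moments of `y` thus pass to
-- the fit.
lemma exists_norm_fit_le : ∃ C, ∀ y ω, ‖fit H sel y ω‖ ≤ C * ‖y‖ := by
  obtain ⟨C, hC⟩ := (Set.finite_range fun k =>
    ‖(Matrix.toEuclideanLin (H k)).toContinuousLinearMap‖).bddAbove
  refine ⟨C, fun y ω => ?_⟩
  refine ((Matrix.toEuclideanLin (H (sel (y + ω)))).toContinuousLinearMap.le_opNorm y).trans ?_
  exact mul_le_mul_of_nonneg_right (hC ⟨_, rfl⟩) (norm_nonneg _)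

lemma measurable_errHat (hsel : ∀ k : M, MeasurableSet (sel ⁻¹' {k})) (σ α : ℝ) :
    Measurable fun p : 𝔼 × 𝔼 => errHat H sel σ α p.1 p.2 := by
  have h1 := measurable_fit (H := H) hsel
  have h2 : Measurable fun p : 𝔼 × 𝔼 => (H (sel (p.1 + p.2))).trace :=
    (measurable_comp_sel hsel fun k => (H k).trace).comp (measurable_fst.add measurable_snd)
  unfold errHat
  fun_prop

variable {Ω : Type*} [MeasurableSpace Ω] {μ : Measure Ω}

lemma memLp_fit (hsel : ∀ k : M, MeasurableSet (sel ⁻¹' {k})) {Y W : Ω → 𝔼} {p : ℝ≥0∞}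
    (hY : MemLp Y p μ) (hW : AEMeasurable W μ) :
    MemLp (fun x => fit H sel (Y x) (W x)) p μ := by
  obtain ⟨C, hC⟩ := exists_norm_fit_le H sel
  refine hY.of_le_mul (c := C) ?_ (Filter.Eventually.of_forall fun x => hC _ _)
  exact ((measurable_fit hsel).comp_aemeasurable
    (hY.1.aemeasurable.prodMk hW)).aestronglyMeasurable

lemma memLp_normSq {V : Ω → 𝔼} (hV : MemLp V 4 μ) : MemLp (fun x => ‖V x‖ ^ 2) 2 μ := by
  have := hV.norm_rpow_div 2
  have h42 : (4 : ℝ≥0∞) / 2 = 2 := by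
    rw [show (4 : ℝ≥0∞) = 2 * 2 by norm_num, ENNReal.mul_div_cancel_right (by norm_num)
      (by norm_num)]
  rw [h42] at this
  simpa using this

lemma memLp_errHat [IsFiniteMeasure μ] (hsel : ∀ k : M, MeasurableSet (sel ⁻¹' {k}))
    (σ α : ℝ) {Y W : Ω → 𝔼}
    (hY : MemLp Y 4 μ) (hW : MemLp W 4 μ) :
    MemLp (fun x => errHat H sel σ α (Y x) (W x)) 2 μ := by
  have hV := memLp_normSq ((hY.sub (hW.const_smul (1 / α))).sub
    (memLp_fit (H := H) hsel hY hW.1.aemeasurable))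
  have htr : MemLp (fun x => 2 * (H (sel (Y x + W x))).trace * σ ^ 2) 2 μ := by
    obtain ⟨C, hC⟩ := (Set.finite_range fun k => ‖2 * (H k).trace * σ ^ 2‖).bddAbove
    refine MemLp.of_bound ?_ C (Filter.Eventually.of_forall fun x => hC ⟨_, rfl⟩)
    exact ((measurable_comp_sel hsel fun k => 2 * (H k).trace * σ ^ 2).comp_aemeasurable
      (hY.1.aemeasurable.add hW.1.aemeasurable)).aestronglyMeasurable
  exact (hV.add htr).sub (memLp_const ((1 / α) * n * σ ^ 2))

lemma memLp_fst_dataLaw (σ α : ℝ) (m : 𝔼) : MemLp Prod.fst 4 (dataLaw σ α m) :=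
  (memLp_id_gauss m _ (by simp)).comp_fst _

lemma memLp_snd_dataLaw (σ α : ℝ) (m : 𝔼) : MemLp Prod.snd 4 (dataLaw σ α m) :=
  (memLp_id_gauss 0 _ (by simp)).comp_snd _

lemma integrable_normSq_sub_fit (hsel : ∀ k : M, MeasurableSet (sel ⁻¹' {k})) (σ α : ℝ) (m : 𝔼) :
    Integrable (fun p : (𝔼 × 𝔼) × 𝔼 => ‖p.2 - fit H sel p.1.1 p.1.2‖ ^ 2)
      ((dataLaw σ α m).prod (gauss m (σ ^ 2))) := by
  have h1 : MemLp (fun p : (𝔼 × 𝔼) × 𝔼 => p.2) 4 ((dataLaw σ α m).prod (gauss m (σ ^ 2))) :=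
    (memLp_id_gauss m _ (by simp)).comp_snd _
  have h2 : MemLp (fun p : (𝔼 × 𝔼) × 𝔼 => fit H sel p.1.1 p.1.2) 4
      ((dataLaw σ α m).prod (gauss m (σ ^ 2))) :=
    (memLp_fit hsel (memLp_fst_dataLaw σ α m) (by fun_prop)).comp_fst _
  exact (memLp_normSq (h1.sub h2)).integrable (by norm_num)

lemma memLp_normSq_const_sub_fit (hsel : ∀ k : M, MeasurableSet (sel ⁻¹' {k})) (σ α : ℝ) (m : 𝔼) :
    MemLp (fun p : 𝔼 × 𝔼 => ‖m - fit H sel p.1 p.2‖ ^ 2) 2 (dataLaw σ α m) :=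
  memLp_normSq ((memLp_const m).sub (memLp_fit hsel (memLp_fst_dataLaw σ α m) (by fun_prop)))

lemma predErr_eq (hsel : ∀ k : M, MeasurableSet (sel ⁻¹' {k})) (σ α : ℝ) (m : 𝔼) :
    predErr H sel σ α m =
      ∫ p, (n * σ ^ 2 + ‖m - fit H sel p.1 p.2‖ ^ 2) ∂(dataLaw σ α m) := by
  rw [predErr, integral_prod _ (integrable_normSq_sub_fit hsel σ α m)]
  congr 1 with p
  -- With `(y, ω)` fixed the predictor does not depend on `y_new`, which is the case `K = 0`.
  have h := integral_normSq_sub_normSq_gauss m (fit H sel p.1 p.2) (sq_nonneg σ) 0 |>.2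
  have hi : Integrable (fun z : 𝔼 => ‖z - fit H sel p.1 p.2‖ ^ 2) (gauss m (σ ^ 2)) :=
    (memLp_normSq ((memLp_id_gauss m _ (by simp)).sub (memLp_const _))).integrable (by norm_num)
  simp only [map_zero, LinearMap.zero_apply, add_zero, Matrix.trace_zero, mul_zero, sub_zero] at h
  rw [integral_sub hi (integrable_const _)] at h
  simp only [integral_const, probReal_univ, one_smul] at h
  linarith

/-- The estimator `errHat` is unbiased for the prediction error. -/
lemma integral_errHat (hsel : ∀ k : M, MeasurableSet (sel ⁻¹' {k})) {σ α : ℝ} (hα : 0 < α)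
    (m : 𝔼) :
    ∫ p, errHat H sel σ α p.1 p.2 ∂(dataLaw σ α m) = predErr H sel σ α m := by
  have hi1 := (memLp_errHat (H := H) hsel σ α (memLp_fst_dataLaw σ α m)
    (memLp_snd_dataLaw σ α m)).integrable (by norm_num)
  have hi2 : Integrable (fun p : 𝔼 × 𝔼 => n * σ ^ 2 + ‖m - fit H sel p.1 p.2‖ ^ 2)
      (dataLaw σ α m) :=
    (integrable_const _).add ((memLp_normSq_const_sub_fit hsel σ α m).integrable (by norm_num))
  rw [predErr_eq hsel, ← sub_eq_zero, ← integral_sub hi1 hi2]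
  set D : 𝔼 × 𝔼 → ℝ := fun p =>
    errHat H sel σ α p.1 p.2 - (n * σ ^ 2 + ‖m - fit H sel p.1 p.2‖ ^ 2) with hD
  have hDm : Measurable D :=
    (measurable_errHat hsel σ α).sub (((measurable_fit hsel).const_sub m).norm.pow_const 2
      |>.const_add _)
  have hα' : 1 + α ≠ 0 := by positivity
  -- `B` recovers `(y, ω)` from `(u, z)`. Its components sum to `u`, so the selected model is
  -- constant in `z`.
  let B : 𝔼 × 𝔼 → 𝔼 × 𝔼 := fun q =>
    ((1 + α)⁻¹ • (q.1 + α • q.2), q.1 - (1 + α)⁻¹ • (q.1 + α • q.2))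
  have hBm : Measurable B := by fun_prop
  have hBA : ∀ p : 𝔼 × 𝔼, B (p.1 + p.2, p.1 - (1 / α) • p.2) = p := by
    intro p
    have h : (1 + α)⁻¹ • (p.1 + p.2 + α • (p.1 - (1 / α) • p.2)) = p.1 := by
      match_scalars <;> field_simp
      ring
    simp only [B, h, add_sub_cancel_left]
  have hAm : Measurable fun p : 𝔼 × 𝔼 => (p.1 + p.2, p.1 - (1 / α) • p.2) := by fun_prop
  have hDB : Integrable (D ∘ B)
      ((gauss m ((1 + α) * σ ^ 2)).prod (gauss m ((1 + 1 / α) * σ ^ 2))) := by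
    rw [← map_dataLaw hα m, integrable_map_measure
      (hDm.comp hBm).aestronglyMeasurable hAm.aemeasurable]
    simp only [Function.comp_def, hBA]
    exact hi1.sub hi2
  have hchange : ∫ p, D p ∂(dataLaw σ α m) = ∫ q, (D ∘ B) q
      ∂((gauss m ((1 + α) * σ ^ 2)).prod (gauss m ((1 + 1 / α) * σ ^ 2))) := by
    rw [← map_dataLaw hα m, integral_map hAm.aemeasurable (hDm.comp hBm).aestronglyMeasurable]
    simp only [Function.comp_apply, hBA]
  rw [hchange, integral_prod _ hDB]
  refine integral_eq_zero_of_ae (Filter.Eventually.of_forall fun u => ?_)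
  have hs : 0 ≤ (1 + 1 / α) * σ ^ 2 := by positivity
  set K := H (sel u) with hK
  obtain ⟨hint, h⟩ := integral_normSq_sub_normSq_gauss m ((1 + α)⁻¹ • Matrix.toEuclideanLin K u) hs
    (((1 + α)⁻¹ * α) • K)
  have hpt : ∀ z : 𝔼, (D ∘ B) (u, z) =
      (‖z - ((1 + α)⁻¹ • Matrix.toEuclideanLin K u +
          Matrix.toEuclideanLin (((1 + α)⁻¹ * α) • K) z)‖ ^ 2 -
        ‖m - ((1 + α)⁻¹ • Matrix.toEuclideanLin K u +
          Matrix.toEuclideanLin (((1 + α)⁻¹ * α) • K) z)‖ ^ 2) +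
      (2 * K.trace * σ ^ 2 - (1 / α) * n * σ ^ 2 - n * σ ^ 2) := by
    intro z
    have hy : (1 + α)⁻¹ • (u + α • z) - (1 / α) • (u - (1 + α)⁻¹ • (u + α • z)) = z := by
      match_scalars <;> field_simp <;> ring
    have hf : fit H sel ((1 + α)⁻¹ • (u + α • z)) (u - (1 + α)⁻¹ • (u + α • z)) =
        (1 + α)⁻¹ • Matrix.toEuclideanLin K u +
          Matrix.toEuclideanLin (((1 + α)⁻¹ * α) • K) z := by
      simp [fit, hK, smul_smul]
    simp only [hD, B, Function.comp_apply, errHat, hy, hf, add_sub_cancel]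
    rw [← hK]
    ring
  simp_rw [hpt]
  rw [integral_add hint (integrable_const _), h]
  simp
  field_simp
  ring

end Fit

/-! ### Variance under conditioning, and the main theorem -/

lemma evariance_eq_eLpNorm_sq {Ω : Type*} [MeasurableSpace Ω] (X : Ω → ℝ) (μ : Measure Ω) :
    evariance X μ = eLpNorm (fun x => X x - ∫ x, X x ∂μ) 2 μ ^ 2 := by
  rw [eLpNorm_eq_lintegral_rpow_enorm_toReal (by norm_num) (by norm_num), evariance,
    ← ENNReal.rpow_natCast, ← ENNReal.rpow_mul]
  simp

/-- Conditioning does not increase the variance, whether finite or not. -/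
lemma evariance_condExp_le {Ω : Type*} {m m0 : MeasurableSpace Ω} (hm : m ≤ m0) {μ : Measure Ω}
    [IsProbabilityMeasure μ] {X : Ω → ℝ} (hX : Integrable X μ) :
    evariance (μ[X | m]) μ ≤ evariance X μ := by
  rw [evariance_eq_eLpNorm_sq, evariance_eq_eLpNorm_sq, integral_condExp hm]
  refine pow_le_pow_left₀ zero_le ?_ 2
  -- Contraction in the extended `L²` seminorm needs no finite second moment, so infinite variance
  -- is covered.
  have h := eLpNorm_condExp_le_eLpNorm (m := m) (μ := μ) (X - fun _ => ∫ x, X x ∂μ) one_le_two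
  refine (eLpNorm_congr_ae ?_).le.trans h
  filter_upwards [condExp_sub hX (integrable_const (∫ x, X x ∂μ)) m] with x hx
  rw [hx, condExp_const hm]
  rfl

end RandSel

open RandSel

theorem mainTheorem7 {n : ℕ} {M : Type*} [Finite M]
    (sel : EuclideanSpace ℝ (Fin n) → M) (hsel : ∀ k : M, MeasurableSet (sel ⁻¹' {k}))
    (H : M → Matrix (Fin n) (Fin n) ℝ)
    (σ : ℝ) (hσ : 0 < σ)
    (T : Set (EuclideanSpace ℝ (Fin n)))
    (hT : ∃ (c : EuclideanSpace ℝ (Fin n)) (r : ℝ), 0 < r ∧ Metric.ball c r ⊆ T)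
    (α : ℝ) (hα : 0 < α) :
    -- the prediction error is a finite expectation
    (∀ m ∈ T, Integrable (fun p => ‖p.2 - RandSel.fit H sel p.1.1 p.1.2‖ ^ 2)
      ((RandSel.dataLaw σ α m).prod (RandSel.gauss m (σ ^ 2)))) ∧
    -- averaging over `ω` is well defined and is a version of the conditional expectation given `y`
    (∀ y, Integrable (fun ω => RandSel.errHat H sel σ α y ω) (RandSel.gauss 0 (α * σ ^ 2))) ∧
    (∀ m ∈ T, (RandSel.dataLaw σ α m)[fun p => RandSel.errHat H sel σ α p.1 p.2 |
        MeasurableSpace.comap Prod.fst inferInstance]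
      =ᵐ[RandSel.dataLaw σ α m] fun p => RandSel.errHatI H sel σ α p.1) ∧
    -- UMVU among all estimators that are functions of `(y, ω)`
    RandSel.IsUMVU (RandSel.dataLaw σ α) T (RandSel.predErr H sel σ α)
      (fun p => RandSel.errHatI H sel σ α p.1) := by
  have hmem : ∀ m, MemLp (fun p : EuclideanSpace ℝ (Fin n) × EuclideanSpace ℝ (Fin n) =>
      errHat H sel σ α p.1 p.2) 2 (dataLaw σ α m) := fun m =>
    memLp_errHat hsel σ α (memLp_fst_dataLaw σ α m) (memLp_snd_dataLaw σ α m)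
  have hcond : ∀ m, (dataLaw σ α m)[fun p => errHat H sel σ α p.1 p.2 |
        MeasurableSpace.comap Prod.fst inferInstance]
      =ᵐ[dataLaw σ α m] fun p => errHatI H sel σ α p.1 := fun m =>
    condExp_fst_prod (measurable_errHat hsel σ α) ((hmem m).integrable (by norm_num))
  have hmI : Measurable (errHatI H sel σ α) :=
    (measurable_errHat hsel σ α).stronglyMeasurable.integral_prod_right'.measurable
  have hmemI : ∀ m, MemLp (fun p : EuclideanSpace ℝ (Fin n) × EuclideanSpace ℝ (Fin n) =>
      errHatI H sel σ α p.1) 2 (dataLaw σ α m) := fun m =>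
    (memLp_congr_ae (hcond m)).1 ((hmem m).condExp one_le_two)
  have hunb : IsUnbiased (dataLaw σ α) T (predErr H sel σ α) fun p => errHatI H sel σ α p.1 :=
    { measurable := hmI.comp measurable_fst
      integrable := fun m _ => (hmemI m).integrable (by norm_num)
      mean_eq := fun m _ => by
        rw [← integral_errHat hsel hα m, ← integral_congr_ae (hcond m),
          integral_condExp measurable_fst.comap_le] }
  refine ⟨fun m _ => integrable_normSq_sub_fit hsel σ α m, fun y => ?_, fun m _ => hcond m,
    hunb, fun m _ => hmemI m, fun d hd m hm => ?_⟩
  · exact (memLp_errHat hsel σ α (memLp_const y)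
      (memLp_id_gauss 0 _ (by simp))).integrable (by norm_num)
  · obtain ⟨c, r, hr, hball⟩ := hT
    have hσ2 : 0 < σ ^ 2 := by positivity
    -- The Rao–Blackwellization of the competitor; completeness will identify it with `errHatI`.
    set e : EuclideanSpace ℝ (Fin n) → ℝ := fun y => ∫ ω, d (y, ω) ∂(gauss 0 (α * σ ^ 2)) with he
    have hdi : ∀ θ ∈ T, Integrable d ((gauss θ (σ ^ 2)).prod (gauss 0 (α * σ ^ 2))) :=
      hd.integrable
    have hem : Measurable e := hd.measurable.stronglyMeasurable.integral_prod_right'.measurable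
    have hei : ∀ θ ∈ T, Integrable e (gauss θ (σ ^ 2)) := fun θ hθ => (hdi θ hθ).integral_prod_left
    have hIi : ∀ θ ∈ T, Integrable (errHatI H sel σ α) (gauss θ (σ ^ 2)) := fun θ _ =>
      Integrable.integral_prod_left (ν := gauss 0 (α * σ ^ 2))
        (f := fun p => errHat H sel σ α p.1 p.2) ((hmem θ).integrable (by norm_num))
    have hzero : ∀ θ ∈ T, ∫ y, (e y - errHatI H sel σ α y) ∂(gauss θ (σ ^ 2)) = 0 := by
      intro θ hθ
      have h1 : ∫ y, e y ∂(gauss θ (σ ^ 2)) = predErr H sel σ α θ := by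
        rw [← hd.mean_eq θ hθ, dataLaw, integral_prod _ (hdi θ hθ)]
      have h2 : ∫ y, errHatI H sel σ α y ∂(gauss θ (σ ^ 2)) = predErr H sel σ α θ := by
        rw [← hunb.mean_eq θ hθ, dataLaw, integral_fun_fst]
        simp
      rw [integral_sub (hei θ hθ) (hIi θ hθ), h1, h2, sub_self]
    have hae := ae_eq_zero_of_integral_gauss_eq_zero (hem.sub hmI) hσ2 hr
      (fun θ hθ => (hei θ (hball hθ)).sub (hIi θ (hball hθ))) fun θ hθ => hzero θ (hball hθ)
    have hae' : e =ᵐ[gauss m (σ ^ 2)] errHatI H sel σ α := by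
      filter_upwards [(gauss_absolutelyContinuous c m hσ2).ae_le hae] with y hy
      exact sub_eq_zero.1 hy
    have hae2 : (fun p : EuclideanSpace ℝ (Fin n) × EuclideanSpace ℝ (Fin n) =>
        errHatI H sel σ α p.1) =ᵐ[dataLaw σ α m] fun p => e p.1 :=
      Measure.quasiMeasurePreserving_fst.ae_eq_comp hae'.symm
    have hce := condExp_fst_prod hd.measurable (hdi m hm)
    rw [evariance_congr (hae2.trans hce.symm)]
    exact evariance_condExp_le measurable_fst.comap_le (hd.integrable m hm)
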